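/- Identify a probability law on $\mathbb R$ with its distribution function $F$, let $*$ denote convolution, let $\|H\|$ denote the total variation on $\mathbb R$ of a function $H:\mathbb R\to\mathbb R$, and let $\mathrm{Supp}(F)=\{x\in\mathbb R: F(x+\varepsilon)-F(x-\varepsilon)>0 \text{ for every } \varepsilon>0\}$. A law $F$ is infinitely divisible if for every integer $n\ge 1$ it is the $n$-fold convolution power of some probability law, and rational-infinitely divisible if $F_1=F*F_2$ for some infinitely divisible laws $F_1,F_2$. A law is discrete if it is concentrated on a countable set, and discrete lattice if it is discrete and $\mathrm{Supp}(F)\subset\{a+bk:k\in\mathbb Z\}$ for some $a\in\mathbb R$ and $b>0$. A class $\mathcal A$ of laws is dense in variation in a class $\mathcal B$ if for every $F\in\mathcal B$ and $\varepsilon>0$ there is $G\in\mathcal A$ with $\|F-G\|<\varepsilon$. Theorem. Let $a\in\mathbb R$, $b>0$, and let $L$ be a nonempty subset of $\{a+bk:k\in\mathbb Z\}$. Then the class of discrete rational-infinitely divisible laws $F$ with $\mathrm{Supp}(F)\subset L$ is dense in variation in the class of all discrete laws $F$ with $\mathrm{Supp}(F)\subset L$. Consequently, the class of rational-infinitely divisible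 discrete lattice laws is dense in variation in the class of all discrete lattice laws. -/

import Mathlib

open MeasureTheory ProbabilityTheory Set
open scoped ENNReal

namespace RationalID

/-! Probability laws on the real line are elements of `ProbabilityMeasure ℝ`; the distribution
function of a law `F` is `cdf F`. -/

/-- The `n`-fold convolution power of a law (the unit mass at `0` for `n = 0`). -/
noncomputable def convPow (F : ProbabilityMeasure ℝ) : ℕ → Measure ℝ
  | 0 => Measure.dirac 0
  | n + 1 => Measure.conv (convPow F n) (F : Measure ℝ)

/-- Infinitely divisible laws: for every `n ≥ 1`, the law is the `n`-fold convolution power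
of some law. -/
def ID : Set (ProbabilityMeasure ℝ) :=
  {F | ∀ n : ℕ, 1 ≤ n → ∃ G : ProbabilityMeasure ℝ, (F : Measure ℝ) = convPow G n}

/-- Rational-infinitely divisible laws: `F₁ = F * F₂` for some infinitely divisible
`F₁` and `F₂`. -/
def RID : Set (ProbabilityMeasure ℝ) :=
  {F | ∃ F₁ ∈ ID, ∃ F₂ ∈ ID, (F₁ : Measure ℝ) = Measure.conv (F : Measure ℝ) (F₂ : Measure ℝ)}

/-- Discrete laws: those concentrated on a countable set. -/
def DFdisc : Set (ProbabilityMeasure ℝ) :=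
  {F | ∃ C : Set ℝ, C.Countable ∧ (F : Measure ℝ) Cᶜ = 0}

/-- Discrete laws with support (the set of points of increase of the distribution function)
contained in `S`. -/
def DFdiscOn (S : Set ℝ) : Set (ProbabilityMeasure ℝ) :=
  {F | F ∈ DFdisc ∧ (F : Measure ℝ).support ⊆ S}

/-- Discrete rational-infinitely divisible laws with support contained in `S`. -/
def RIDdiscOn (S : Set ℝ) : Set (ProbabilityMeasure ℝ) :=
  RID ∩ DFdiscOn S

/-- The lattice `{a + b k : k ∈ ℤ}`. -/
def lattice (a b : ℝ) : Set ℝ :=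
  range fun k : ℤ => a + b * (k : ℝ)

/-- Discrete lattice laws: the support is contained in some lattice `{a + b k : k ∈ ℤ}`
with `b > 0`. -/
def DFlat : Set (ProbabilityMeasure ℝ) :=
  {F | F ∈ DFdisc ∧ ∃ a b : ℝ, 0 < b ∧ (F : Measure ℝ).support ⊆ lattice a b}

/-- Discrete lattice laws that are rational-infinitely divisible. -/
def RIDlat : Set (ProbabilityMeasure ℝ) :=
  RID ∩ DFlat

/-- The total variation on `ℝ` of the difference of the distribution functions of two laws. -/
noncomputable def varDist (F G : ProbabilityMeasure ℝ) : ℝ≥0∞ :=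
  eVariationOn (fun x : ℝ => cdf (F : Measure ℝ) x - cdf (G : Measure ℝ) x) univ

/-- The class `A` is dense in variation in the class `B`: every law in `B` is a limit in total
variation of laws in `A`. -/
def DenseInVariation (A B : Set (ProbabilityMeasure ℝ)) : Prop :=
  ∀ F ∈ B, ∀ ε : ℝ, 0 < ε → ∃ G ∈ A, varDist F G < ENNReal.ofReal ε

end RationalID

/-! A finitely supported law on `{a + b k}` has characteristic function `exp(iγt) P(exp(ibt))` with
`P` a polynomial. If `P` has no zeros on the unit circle, factoring it over `ℂ` and expanding each
logarithm gives `P(exp(it)) = exp(imt + ∑ ν k exp(ikt))` with `ν` summable (`isLogLaurent_eval`).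
This is a Lévy–Khinchine formula with complex Lévy weights. Hermitian symmetry of the characteristic
function makes the real parts suffice (`mem_RID_of_charFun_eq`), and the Jordan parts of the real
weights give two shifted compound Poisson laws exhibiting rational-infinite divisibility.

Density thus reduces to avoiding zeros on the circle. After truncation and normalization,
exponential tilting replaces `P(z)` by `P(rz)/P(r)`: it creates no new atoms, depends continuously
on `r`, and fails only for finitely many `r > 1` (`exists_tilted_weights`). -/

namespace RationalID

open Complex

/-! ### Purely atomic measures -/

section Atomic

variable {ι : Type*}

/-- The measure with mass `p k` at the point `x k`. -/
noncomputable def atomic (p : ι → ℝ) (x : ι → ℝ) : Measure ℝ :=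
  Measure.sum fun k => ENNReal.ofReal (p k) • Measure.dirac (x k)

variable {p : ι → ℝ} {x : ι → ℝ}

lemma atomic_apply {A : Set ℝ} (hA : MeasurableSet A) :
    atomic p x A = ∑' k, ENNReal.ofReal (p k) * A.indicator 1 (x k) := by
  simp [atomic, Measure.sum_apply _ hA, Measure.dirac_apply' _ hA]

lemma atomic_univ (hp : ∀ k, 0 ≤ p k) (hs : Summable p) :
    atomic p x univ = ENNReal.ofReal (∑' k, p k) := by
  simp [atomic_apply MeasurableSet.univ, ENNReal.ofReal_tsum_of_nonneg hp hs]

lemma isFiniteMeasure_atomic (hp : ∀ k, 0 ≤ p k) (hs : Summable p) :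
    IsFiniteMeasure (atomic p x) :=
  ⟨by rw [atomic_univ hp hs]; exact ENNReal.ofReal_lt_top⟩

lemma atomic_real (hp : ∀ k, 0 ≤ p k) {A : Set ℝ} (hA : MeasurableSet A) :
    (atomic p x).real A = ∑' k, p k * A.indicator 1 (x k) := by
  rw [measureReal_def, atomic_apply hA, ENNReal.tsum_toReal_eq]
  · congr 1 with k
    by_cases h : x k ∈ A <;> simp [h, hp k]
  · intro k
    by_cases h : x k ∈ A <;> simp [h]

lemma charFun_atomic [Countable ι] (hp : ∀ k, 0 ≤ p k) (hs : Summable p) (t : ℝ) :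
    charFun (atomic p x) t = ∑' k, (p k : ℂ) * cexp (t * x k * I) := by
  have := isFiniteMeasure_atomic (x := x) hp hs
  rw [charFun_apply_real, atomic, integral_sum_measure]
  · congr 1 with k
    simp [hp k]
  · change Integrable _ (atomic p x)
    refine (integrable_const (1 : ℝ)).mono' (by fun_prop) (ae_of_all _ fun y => ?_)
    rw [← ofReal_mul, norm_exp_ofReal_mul_I]

end Atomic

/-! ### Compound Poisson laws and their infinite divisibility -/

section CompoundPoisson

/-- Convolution powers of a measure. -/
noncomputable def measurePow (μ : Measure ℝ) : ℕ → Measure ℝ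
  | 0 => Measure.dirac 0
  | n + 1 => Measure.conv (measurePow μ n) μ

variable (μ : Measure ℝ) [IsFiniteMeasure μ]

instance isFiniteMeasure_measurePow (n : ℕ) : IsFiniteMeasure (measurePow μ n) := by
  induction n with
  | zero => unfold measurePow; infer_instance
  | succ n ih => unfold measurePow; infer_instance

lemma charFun_measurePow (n : ℕ) (t : ℝ) : charFun (measurePow μ n) t = charFun μ t ^ n := by
  induction n with
  | zero => simp [measurePow]
  | succ n ih => rw [measurePow, charFun_conv, ih, pow_succ]

lemma measurePow_univ (n : ℕ) : measurePow μ n univ = ENNReal.ofReal (μ.real univ ^ n) := by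
  have h := charFun_measurePow μ n 0
  rw [charFun_zero, charFun_zero] at h
  have h' : (measurePow μ n).real univ = μ.real univ ^ n := by exact_mod_cast h
  rw [← h', ofReal_measureReal]

lemma convPow_eq_measurePow (F : ProbabilityMeasure ℝ) (n : ℕ) :
    convPow F n = measurePow (F : Measure ℝ) n := by
  induction n with
  | zero => rfl
  | succ n ih => rw [convPow, measurePow, ih]

/-- The compound Poisson law with Lévy measure `μ`. -/
noncomputable def compoundPoisson : Measure ℝ :=
  Measure.sum fun n : ℕ =>
    ENNReal.ofReal (Real.exp (-μ.real univ) * ((n.factorial : ℝ))⁻¹) • measurePow μ n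

instance isProbabilityMeasure_compoundPoisson : IsProbabilityMeasure (compoundPoisson μ) := by
  constructor
  have h := NormedSpace.expSeries_div_hasSum_exp (μ.real univ)
  rw [← Real.exp_eq_exp_ℝ] at h
  have h2 := h.mul_left (Real.exp (-μ.real univ))
  rw [← Real.exp_add, neg_add_cancel, Real.exp_zero] at h2
  rw [compoundPoisson, Measure.sum_apply _ MeasurableSet.univ, ← ENNReal.ofReal_one,
    ← h2.tsum_eq, ENNReal.ofReal_tsum_of_nonneg (fun n => by positivity) h2.summable]
  congr 1 with n
  rw [Measure.smul_apply, measurePow_univ, smul_eq_mul, ← ENNReal.ofReal_mul (by positivity)]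
  congr 1
  ring

lemma charFun_compoundPoisson (t : ℝ) :
    charFun (compoundPoisson μ) t = cexp (charFun μ t - μ.real univ) := by
  rw [charFun_apply_real, compoundPoisson, integral_sum_measure]
  · have h := NormedSpace.expSeries_div_hasSum_exp (charFun μ t)
    rw [← Complex.exp_eq_exp_ℂ] at h
    have h2 := h.mul_left (cexp (-μ.real univ))
    rw [← Complex.exp_add, neg_add_eq_sub] at h2
    rw [← h2.tsum_eq]
    congr 1 with n
    rw [integral_smul_measure, ← charFun_apply_real, charFun_measurePow,
      ENNReal.toReal_ofReal (by positivity), real_smul]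
    push_cast
    ring
  · change Integrable _ (compoundPoisson μ)
    refine (integrable_const (1 : ℝ)).mono' (by fun_prop) (ae_of_all _ fun y => ?_)
    rw [← ofReal_mul, norm_exp_ofReal_mul_I]

/-- The law of `γ + X`, with `X` compound Poisson with Lévy measure `μ`. -/
noncomputable def shiftedPoisson (γ : ℝ) : ProbabilityMeasure ℝ :=
  ⟨Measure.conv (Measure.dirac γ) (compoundPoisson μ), inferInstance⟩

lemma charFun_shiftedPoisson (γ t : ℝ) :
    charFun (shiftedPoisson μ γ : Measure ℝ) t =
      cexp (t * γ * I + (charFun μ t - μ.real univ)) := by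
  change charFun (Measure.conv (Measure.dirac γ) (compoundPoisson μ)) t = _
  rw [charFun_conv, charFun_dirac, charFun_compoundPoisson, ← Complex.exp_add]
  simp

/-- The exponent is linear in `(γ, μ)`, so dividing both by `n` gives an `n`-th convolution root. -/
lemma shiftedPoisson_mem_ID (γ : ℝ) : shiftedPoisson μ γ ∈ ID := by
  intro n hn
  have hn0 : (n : ℂ) ≠ 0 := by exact_mod_cast (by omega : n ≠ 0)
  set c : NNReal := (n : NNReal)⁻¹ with hc
  refine ⟨shiftedPoisson (c • μ) (γ / n), ?_⟩
  rw [convPow_eq_measurePow]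
  apply Measure.ext_of_charFun
  ext t
  have h1 : charFun (c • μ) t = (n : ℂ)⁻¹ * charFun μ t := by
    rw [charFun_apply_real, charFun_apply_real, integral_smul_nnreal_measure, hc,
      NNReal.smul_def, real_smul]
    simp
  have h2 : (((c • μ).real univ : ℝ) : ℂ) = (n : ℂ)⁻¹ * (μ.real univ : ℝ) := by
    rw [← charFun_zero, ← charFun_zero]
    rw [charFun_apply_real, charFun_apply_real, integral_smul_nnreal_measure, hc,
      NNReal.smul_def, real_smul]
    simp
  rw [charFun_measurePow, charFun_shiftedPoisson, charFun_shiftedPoisson, h1, h2,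
    ← Complex.exp_nat_mul]
  congr 1
  push_cast
  field_simp

end CompoundPoisson

/-! ### From signed or complex Lévy weights to rational-infinite divisibility -/

section Criterion

variable {ι : Type*} {ν : ι → ℝ} {x : ι → ℝ}

lemma norm_cexp_mul_mul_I (t y : ℝ) : ‖cexp (t * y * I)‖ = 1 := by
  rw [← ofReal_mul, norm_exp_ofReal_mul_I]

lemma summable_mul_cexp {ν : ι → ℂ} (hν : Summable ν) (t : ℝ) :
    Summable fun k => ν k * cexp (t * x k * I) := by
  refine Summable.of_norm ?_
  simpa [norm_cexp_mul_mul_I] using hν.norm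

variable [Countable ι]

lemma charFun_atomic_sub_real (hp : ∀ k, 0 ≤ ν k) (hs : Summable ν) (t : ℝ) :
    charFun (atomic ν x) t - (atomic ν x).real univ =
      ∑' k, (ν k : ℂ) * (cexp (t * x k * I) - 1) := by
  have hs' : Summable fun k => (ν k : ℂ) := by exact_mod_cast hs
  have h0 := charFun_atomic (x := x) hp hs 0
  rw [charFun_zero] at h0
  rw [h0, charFun_atomic hp hs, ← (summable_mul_cexp hs' t).tsum_sub (summable_mul_cexp hs' 0)]
  congr 1 with k
  simp [mul_sub]

/-- A law with a Lévy–Khinchine representation with summable signed discrete Lévy measure is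
rational-infinitely divisible. -/
theorem mem_RID_of_charFun_eq_real (F : ProbabilityMeasure ℝ) (γ : ℝ) (hν : Summable ν)
    (hF : ∀ t : ℝ, charFun (F : Measure ℝ) t =
      cexp (t * γ * I + ∑' k, (ν k : ℂ) * (cexp (t * x k * I) - 1))) : F ∈ RID := by
  have hp : Summable fun k => (ν k)⁺ := hν.abs.of_nonneg_of_le (fun k => posPart_nonneg _)
    fun k => by rw [← posPart_add_negPart]; exact le_add_of_nonneg_right (negPart_nonneg _)
  have hm : Summable fun k => (ν k)⁻ := hν.abs.of_nonneg_of_le (fun k => negPart_nonneg _)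
    fun k => by rw [← posPart_add_negPart]; exact le_add_of_nonneg_left (posPart_nonneg _)
  have := isFiniteMeasure_atomic (x := x) (fun k => posPart_nonneg (ν k)) hp
  have := isFiniteMeasure_atomic (x := x) (fun k => negPart_nonneg (ν k)) hm
  refine ⟨shiftedPoisson (atomic (fun k => (ν k)⁺) x) γ, shiftedPoisson_mem_ID _ _,
    shiftedPoisson (atomic (fun k => (ν k)⁻) x) 0, shiftedPoisson_mem_ID _ _, ?_⟩
  apply Measure.ext_of_charFun
  ext t
  rw [charFun_conv, charFun_shiftedPoisson, charFun_shiftedPoisson, hF, ← Complex.exp_add,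
    charFun_atomic_sub_real (fun k => posPart_nonneg (ν k)) hp,
    charFun_atomic_sub_real (fun k => negPart_nonneg (ν k)) hm]
  have key : ∑' k, (((ν k)⁺ : ℝ) : ℂ) * (cexp (t * x k * I) - 1) =
      ∑' k, (ν k : ℂ) * (cexp (t * x k * I) - 1) +
      ∑' k, (((ν k)⁻ : ℝ) : ℂ) * (cexp (t * x k * I) - 1) := by
    have sub {f : ι → ℝ} (hf : Summable f) :
        Summable fun k => (f k : ℂ) * (cexp (t * x k * I) - 1) := by
      have hf' : Summable fun k => (f k : ℂ) := by exact_mod_cast hf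
      simpa [mul_sub] using (summable_mul_cexp hf' t).sub hf'
    rw [← (sub hν).tsum_add (sub hm)]
    congr 1 with k
    rw [← add_mul, ← ofReal_add]
    congr 3
    have := posPart_sub_negPart (ν k)
    linarith
  rw [key]
  congr 1
  push_cast
  ring

/-- In a Lévy–Khinchine representation of a law on the line, a summable complex discrete Lévy
measure can be replaced by its real part. -/
theorem mem_RID_of_charFun_eq (F : ProbabilityMeasure ℝ) (γ : ℝ) {ν : ι → ℂ} (hν : Summable ν)
    (hF : ∀ t : ℝ, charFun (F : Measure ℝ) t =
      cexp (t * γ * I + ∑' k, ν k * (cexp (t * x k * I) - 1))) : F ∈ RID := by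
  have hre : Summable fun k => (ν k).re := (Complex.hasSum_re hν.hasSum).summable
  have him : Summable fun k => (ν k).im := (Complex.hasSum_im hν.hasSum).summable
  have sub {f : ι → ℂ} (hf : Summable f) (t : ℝ) :
      Summable fun k => f k * (cexp (t * x k * I) - 1) := by
    simpa [mul_sub] using (summable_mul_cexp hf t).sub hf
  have hre' : Summable fun k => ((ν k).re : ℂ) := by exact_mod_cast hre
  have him' : Summable fun k => ((ν k).im : ℂ) := by exact_mod_cast him
  set A : ℝ → ℂ := fun t => ∑' k, ((ν k).re : ℂ) * (cexp (t * x k * I) - 1) with hA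
  set B : ℝ → ℂ := fun t => ∑' k, ((ν k).im : ℂ) * (cexp (t * x k * I) - 1) with hB
  have hAB (t : ℝ) : ∑' k, ν k * (cexp (t * x k * I) - 1) = A t + I * B t := by
    rw [hA, hB]
    simp only
    rw [← tsum_mul_left, ← (sub hre' t).tsum_add ((sub him' t).mul_left I)]
    congr 1 with k
    conv_lhs => rw [← re_add_im (ν k)]
    ring
  have conjtsum (f : ι → ℝ) (t : ℝ) :
      (starRingEnd ℂ) (∑' k, (f k : ℂ) * (cexp (t * x k * I) - 1)) =
        ∑' k, (f k : ℂ) * (cexp ((-t : ℝ) * x k * I) - 1) := by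
    rw [conj_tsum]
    congr 1 with k
    simp [← Complex.exp_conj]
  have conjA (t : ℝ) : (starRingEnd ℂ) (A t) = A (-t) := conjtsum _ t
  have conjB (t : ℝ) : (starRingEnd ℂ) (B t) = B (-t) := conjtsum _ t
  -- The characteristic function at `t` is the conjugate of its value at `-t`; as `A` and `B` share
  -- this symmetry, `exp(2iB(t)) = 1`. Continuity and `B 0 = 0` then force `B = 0`.
  have hperiod (t : ℝ) : ∃ n : ℤ, B t = n * Real.pi := by
    have h := charFun_neg (μ := (F : Measure ℝ)) (-t)
    rw [hF, hF, hAB, hAB, ← Complex.exp_conj, map_add, map_add, map_mul, map_mul, map_mul, conjA,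
      conjB] at h
    simp only [conj_ofReal, conj_I, neg_neg] at h
    obtain ⟨n, hn⟩ := Complex.exp_eq_exp_iff_exists_int.1 h
    refine ⟨n, ?_⟩
    have : 2 * I * (B t - n * Real.pi) = 0 := by
      push_cast at hn
      linear_combination hn
    simpa [sub_eq_zero] using this
  have hBcont : Continuous B := by
    refine continuous_tsum (u := fun k => |(ν k).im| * 2) (fun k => by fun_prop)
      (him.abs.mul_right 2) fun k t => ?_
    rw [norm_mul, norm_real, Real.norm_eq_abs]
    gcongr
    refine (norm_sub_le _ _).trans ?_
    rw [norm_cexp_mul_mul_I, norm_one]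
    norm_num
  choose n hn using hperiod
  have hncont : Continuous n := by
    rw [Int.isClosedEmbedding_coe_real.isEmbedding.continuous_iff]
    have : (Int.cast ∘ n : ℝ → ℝ) = fun t => (B t).re / Real.pi := by
      ext t
      have h := congrArg Complex.re (hn t)
      rw [Function.comp_apply, h]
      simp [Real.pi_ne_zero]
    rw [this]
    fun_prop
  have hB0 : B 0 = 0 := by simp [hB]
  have hzero (t : ℝ) : B t = 0 := by
    have h : n t = n 0 := PreconnectedSpace.constant inferInstance hncont
    rw [hn, h, ← hn, hB0]
  refine mem_RID_of_charFun_eq_real (x := x) F γ hre fun t => ?_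
  rw [hF, hAB, hzero, mul_zero, add_zero]

end Criterion

/-! ### Laurent logarithms of polynomials on the unit circle -/

section LogLaurent

/-- Functions of the form `exp (i m t + ∑ ν k exp (i k t))` with `ν` summable over `ℤ`. -/
def IsLogLaurent (f : ℝ → ℂ) : Prop :=
  ∃ (m : ℤ) (ν : ℤ → ℂ), Summable ν ∧
    ∀ t : ℝ, f t = cexp (t * m * I + ∑' k, ν k * cexp (t * (k : ℝ) * I))

lemma IsLogLaurent.mul {f g : ℝ → ℂ} (hf : IsLogLaurent f) (hg : IsLogLaurent g) :
    IsLogLaurent fun t => f t * g t := by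
  obtain ⟨m, ν, hν, hf⟩ := hf
  obtain ⟨n, ρ, hρ, hg⟩ := hg
  refine ⟨m + n, fun k => ν k + ρ k, hν.add hρ, fun t => ?_⟩
  have h := (summable_mul_cexp (x := fun k : ℤ => (k : ℝ)) hν t).tsum_add
    (summable_mul_cexp (x := fun k : ℤ => (k : ℝ)) hρ t)
  simp only [add_mul]
  rw [h, hf, hg, ← Complex.exp_add]
  congr 1
  push_cast
  ring

lemma isLogLaurent_const {c : ℂ} (hc : c ≠ 0) : IsLogLaurent fun _ => c := by
  refine ⟨0, Pi.single 0 (log c), (hasSum_pi_single 0 _).summable, fun t => ?_⟩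
  rw [tsum_eq_single 0 fun k hk => by simp [hk]]
  simp [exp_log hc]

lemma isLogLaurent_exp : IsLogLaurent fun t => cexp (t * I) :=
  ⟨1, 0, summable_zero, fun t => by simp⟩

/-- The factor `1 - w exp (± i t)`, with `‖w‖ < 1`, via the logarithm series. -/
lemma isLogLaurent_one_sub {w : ℂ} (hw : ‖w‖ < 1) {σ : ℤ} (hσ : σ ≠ 0) :
    IsLogLaurent fun t => 1 - w * cexp (t * (σ : ℝ) * I) := by
  have hinj : Function.Injective fun n : ℕ => σ * (n : ℤ) := fun a b h => by
    simpa [hσ] using h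
  -- The term `n = 0` vanishes because division by zero gives zero.
  set u : ℕ → ℂ := fun n => -(w ^ n / n) with hu
  refine ⟨0, Function.extend (fun n : ℕ => σ * (n : ℤ)) u 0, ?_, fun t => ?_⟩
  · exact ((hasSum_extend_zero hinj).2 (hasSum_taylorSeries_neg_log hw).neg).summable
  · have hz : ‖w * cexp (t * (σ : ℝ) * I)‖ < 1 := by
      rwa [norm_mul, norm_cexp_mul_mul_I, mul_one]
    have hne : 1 - w * cexp (t * (σ : ℝ) * I) ≠ 0 := fun h => by
      rw [← sub_eq_zero.1 h] at hz
      simp at hz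
    have h1 := (hasSum_taylorSeries_neg_log hz).neg
    rw [neg_neg] at h1
    have h2 : HasSum (fun k => Function.extend (fun n : ℕ => σ * (n : ℤ)) u 0 k *
        cexp (t * (k : ℝ) * I)) (log (1 - w * cexp (t * (σ : ℝ) * I))) := by
      rw [← hinj.hasSum_iff]
      · refine h1.congr_fun fun n => ?_
        rw [Function.comp_apply, hinj.extend_apply, hu, mul_pow, ← Complex.exp_nat_mul]
        push_cast
        rw [show (n : ℂ) * (t * σ * I) = t * (σ * n) * I by ring]
        ring
      · intro k hk
        rw [Function.extend_apply' _ _ _ hk]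
        simp
    rw [h2.tsum_eq, Int.cast_zero, mul_zero, zero_mul, zero_add, exp_log hne]

/-- Factor out `exp(it)` when `‖w‖ < 1` and `-w` when `‖w‖ > 1`, leaving a convergent logarithm
series; the first case contributes to the winding number `m`. -/
lemma isLogLaurent_exp_sub {w : ℂ} (hw : ‖w‖ ≠ 1) : IsLogLaurent fun t => cexp (t * I) - w := by
  rcases lt_or_gt_of_ne hw with h | h
  · convert isLogLaurent_exp.mul (isLogLaurent_one_sub h (σ := -1) (by norm_num)) using 2 with t
    have : cexp (t * I) * cexp (t * ((-1 : ℤ) : ℝ) * I) = 1 := by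
      rw [← Complex.exp_add]
      simp
    linear_combination w * this
  · have hw0 : w ≠ 0 := by
      rintro rfl
      simp at h
      linarith
    have h' : ‖w⁻¹‖ < 1 := by
      rw [norm_inv]
      exact inv_lt_one_of_one_lt₀ h
    convert (isLogLaurent_const (neg_ne_zero.2 hw0)).mul
      (isLogLaurent_one_sub h' (σ := 1) (by norm_num)) using 2 with t
    field_simp
    simp

open Polynomial in
/-- A polynomial without roots on the unit circle has a Laurent series logarithm there. -/
theorem isLogLaurent_eval {P : ℂ[X]} (hP : ∀ z : ℂ, ‖z‖ = 1 → P.eval z ≠ 0) :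
    IsLogLaurent fun t => P.eval (cexp (t * I)) := by
  have hP0 : P ≠ 0 := by
    rintro rfl
    exact hP 1 (by simp) (by simp)
  have hroots : ∀ w ∈ P.roots, ‖w‖ ≠ 1 := fun w hw h => hP w h (isRoot_of_mem_roots hw)
  have h (s : Multiset ℂ) (hs : ∀ w ∈ s, ‖w‖ ≠ 1) :
      IsLogLaurent fun t => (s.map fun w => cexp (t * I) - w).prod := by
    induction s using Multiset.induction with
    | empty => simpa using isLogLaurent_const one_ne_zero
    | cons a s ih =>
      simp only [Multiset.map_cons, Multiset.prod_cons]
      exact (isLogLaurent_exp_sub (hs a (by simp))).mul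
        (ih fun w hw => hs w (Multiset.mem_cons_of_mem hw))
  convert (isLogLaurent_const (leadingCoeff_ne_zero.2 hP0)).mul (h P.roots hroots) using 2 with t
  exact (IsAlgClosed.splits P).eval_eq_prod_roots _

end LogLaurent

/-- A lattice law whose characteristic function is, up to a shift, a polynomial in `exp (i b t)`
without zeros on the unit circle is rational-infinitely divisible. -/
theorem mem_RID_of_charFun_eq_eval (F : ProbabilityMeasure ℝ) (γ b : ℝ) {P : Polynomial ℂ}
    (hP : ∀ z : ℂ, ‖z‖ = 1 → P.eval z ≠ 0)
    (hF : ∀ t : ℝ, charFun (F : Measure ℝ) t =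
      cexp (t * γ * I) * P.eval (cexp (((b * t : ℝ) : ℂ) * I))) : F ∈ RID := by
  obtain ⟨m, ν, hν, h⟩ := isLogLaurent_eval hP
  beta_reduce at h
  refine mem_RID_of_charFun_eq (x := fun k : ℤ => b * k) F (γ + b * m) hν fun t => ?_
  -- Normalization at `t = 0` permits replacing `exp(ikt)` by `exp(ikt) - 1`, although `∑ ν k`
  -- itself need not vanish.
  have hone : cexp (∑' k, ν k) = 1 := by
    have h0 := hF 0
    rw [h, charFun_zero] at h0
    simpa using h0.symm
  have hsub : ∑' k : ℤ, ν k * (cexp (t * ((b * k : ℝ) : ℂ) * I) - 1) =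
      ∑' k : ℤ, ν k * cexp (((b * t : ℝ) : ℂ) * (k : ℝ) * I) - ∑' k, ν k := by
    rw [← (summable_mul_cexp (x := fun k : ℤ => (k : ℝ)) hν (b * t)).tsum_sub hν]
    congr 1 with k
    rw [mul_sub, mul_one]
    congr 4
    push_cast
    ring
  rw [hF, h, hsub, ← add_sub_assoc, Complex.exp_sub, hone, div_one, ← Complex.exp_add]
  congr 1
  push_cast
  ring

/-! ### Total variation and supports of atomic laws -/

section Variation

variable {ι : Type*} {p q : ι → ℝ} {x : ι → ℝ}

lemma summable_mul_indicator {f : ι → ℝ} (hf : Summable f) (A : Set ℝ) :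
    Summable fun k => f k * A.indicator 1 (x k) := by
  refine hf.abs.of_norm_bounded fun k => ?_
  by_cases h : x k ∈ A <;> simp [h]

/-- Increments of the difference of distribution functions are dominated by those of the monotone
function `g`, which telescope. -/
lemma varDist_le_tsum {F G : ProbabilityMeasure ℝ} (hF : (F : Measure ℝ) = atomic p x)
    (hG : (G : Measure ℝ) = atomic q x) (hp : ∀ k, 0 ≤ p k) (hq : ∀ k, 0 ≤ q k)
    (hps : Summable p) (hqs : Summable q) :
    varDist F G ≤ ENNReal.ofReal (∑' k, |p k - q k|) := by
  have hd : Summable fun k => |p k - q k| := (hps.sub hqs).abs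
  set g : ℝ → ℝ := fun y => ∑' k, |p k - q k| * (Iic y).indicator 1 (x k) with hg
  have hcdf (y : ℝ) : cdf (F : Measure ℝ) y - cdf (G : Measure ℝ) y =
      ∑' k, (p k - q k) * (Iic y).indicator 1 (x k) := by
    rw [cdf_eq_real, cdf_eq_real, hF, hG, atomic_real hp measurableSet_Iic,
      atomic_real hq measurableSet_Iic,
      ← (summable_mul_indicator hps _).tsum_sub (summable_mul_indicator hqs _)]
    simp only [sub_mul]
  have hind {y z : ℝ} (h : y ≤ z) (k : ι) :
      (Iic y).indicator (1 : ℝ → ℝ) (x k) ≤ (Iic z).indicator 1 (x k) :=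
    indicator_le_indicator_of_subset (Iic_subset_Iic.2 h) (fun _ => zero_le_one) _
  have hstep {y z : ℝ} (h : y ≤ z) :
      edist (cdf (F : Measure ℝ) z - cdf (G : Measure ℝ) z)
        (cdf (F : Measure ℝ) y - cdf (G : Measure ℝ) y) ≤ ENNReal.ofReal (g z - g y) := by
    rw [edist_dist, Real.dist_eq, hcdf, hcdf, hg,
      ← (summable_mul_indicator (hps.sub hqs) _).tsum_sub
        (summable_mul_indicator (hps.sub hqs) _),
      ← (summable_mul_indicator hd _).tsum_sub (summable_mul_indicator hd _)]
    refine ENNReal.ofReal_le_ofReal ?_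
    rw [← Real.norm_eq_abs]
    refine tsum_of_norm_bounded (Summable.hasSum
      ((summable_mul_indicator hd _).sub (summable_mul_indicator hd _))) fun k => ?_
    rw [← mul_sub, ← mul_sub, norm_mul, Real.norm_eq_abs, Real.norm_eq_abs,
      abs_of_nonneg (sub_nonneg.2 (hind h k))]
  have hmono : Monotone g := fun y z h =>
    (summable_mul_indicator hd _).tsum_le_tsum
      (fun k => mul_le_mul_of_nonneg_left (hind h k) (abs_nonneg _)) (summable_mul_indicator hd _)
  refine iSup_le fun ⟨n, u, hu, _⟩ => ?_
  calc _ ≤ ∑ i ∈ Finset.range n, ENNReal.ofReal (g (u (i + 1)) - g (u i)) :=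
        Finset.sum_le_sum fun i _ => hstep (hu i.le_succ)
    _ = ENNReal.ofReal (g (u n) - g (u 0)) := by
        rw [← ENNReal.ofReal_sum_of_nonneg fun i _ => sub_nonneg.2 (hmono (hu i.le_succ)),
          Finset.sum_range_sub fun i => g (u i)]
    _ ≤ _ := by
        refine ENNReal.ofReal_le_ofReal ?_
        have h0 : 0 ≤ g (u 0) := tsum_nonneg fun k =>
          mul_nonneg (abs_nonneg _) (indicator_nonneg (fun _ _ => zero_le_one) _)
        have h1 : g (u n) ≤ ∑' k, |p k - q k| :=
          (summable_mul_indicator hd _).tsum_le_tsum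
            (fun k => mul_le_of_le_one_right (abs_nonneg _)
              (indicator_le_self' (fun _ _ => zero_le_one) _)) hd
        linarith

/-- A measure concentrated on the range of an injective sequence is atomic. -/
lemma eq_atomic [Countable ι] (hx : Function.Injective x) (μ : Measure ℝ) [IsFiniteMeasure μ]
    (hμ : μ (range x)ᶜ = 0) : μ = atomic (fun k => μ.real {x k}) x := by
  ext A hA
  have h1 : μ A = μ (⋃ k, A ∩ {x k}) := by
    rw [← inter_iUnion, iUnion_singleton_eq_range]
    exact (measure_inter_conull hμ).symm
  rw [h1, measure_iUnion _ fun k => hA.inter (measurableSet_singleton _), atomic_apply hA]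
  · congr 1 with k
    by_cases h : x k ∈ A
    · simp [h, inter_eq_right.2 (singleton_subset_iff.2 h)]
    · simp [h]
  · intro i j hij
    refine Disjoint.mono inter_subset_right inter_subset_right ?_
    simpa using hx.ne hij

lemma support_atomic_subset {L : Set ℝ} {S : Finset ι} (hS : ∀ k ∉ S, p k = 0)
    (hL : ∀ k, p k ≠ 0 → x k ∈ L) :
    (atomic p x).support ⊆ L ∧ ∃ C : Set ℝ, C.Countable ∧ atomic p x Cᶜ = 0 := by
  classical
  set T : Set ℝ := x '' {k | p k ≠ 0} with hT
  have hfin : T.Finite := (S.finite_toSet.subset fun k hk => by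
    by_contra h
    exact hk (hS k h)).image x
  have hnull : atomic p x Tᶜ = 0 := by
    rw [atomic_apply hfin.measurableSet.compl, ENNReal.tsum_eq_zero]
    intro k
    by_cases h : p k = 0
    · simp [h]
    · have : x k ∈ T := ⟨k, h, rfl⟩
      simp [this]
  refine ⟨(Measure.support_subset_of_isClosed hfin.isClosed hnull).trans ?_,
    T, hfin.countable, hnull⟩
  rintro _ ⟨k, hk, rfl⟩
  exact hL k hk

end Variation

/-! ### Truncation and exponential tilting -/

section Tilting

open Polynomial in
/-- Multiplying the argument of a nonzero polynomial by a suitable `r > 1` close to `1` moves its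
roots off the unit circle. -/
lemma exists_scale_eval_ne_zero {P : ℂ[X]} (hP : P ≠ 0) {δ : ℝ} (hδ : 0 < δ) :
    ∃ r : ℝ, 1 < r ∧ r < 1 + δ ∧ ∀ z : ℂ, ‖z‖ = 1 → P.eval (r * z) ≠ 0 := by
  -- A zero of `P(rz)` on the circle makes `r` the modulus of a root, so finitely many `r` are bad.
  have hfin : ((fun z : ℂ => ‖z‖) '' {z | z ∈ P.roots}).Finite :=
    (P.roots.toFinset.finite_toSet.subset fun z hz => by simpa using hz).image _
  obtain ⟨r, ⟨h1, h2⟩, hr⟩ := (Ioo_infinite (by linarith : 1 < 1 + δ)).exists_notMem_finite hfin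
  refine ⟨r, h1, h2, fun z hz h => hr ⟨r * z, (mem_roots hP).2 h, ?_⟩⟩
  beta_reduce
  rw [norm_mul, hz, mul_one, norm_real, Real.norm_of_nonneg (by linarith)]

/-- Truncation followed by exponential tilting: weights on `ℤ` are approximated by finitely
supported ones whose generating polynomial has no zeros on the unit circle. -/
theorem exists_tilted_weights {p : ℤ → ℝ} (hp : ∀ k, 0 ≤ p k) (hs : HasSum p 1) {ε : ℝ}
    (hε : 0 < ε) :
    ∃ (S : Finset ℤ) (N : ℤ) (e : ℤ → ℕ) (w : ℤ → ℝ), (∀ k, 0 ≤ w k) ∧ (∀ k ∉ S, w k = 0) ∧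
      (∀ k, p k = 0 → w k = 0) ∧ ∑ k ∈ S, w k = 1 ∧ (∀ k ∈ S, (e k : ℤ) = k + N) ∧
      (∀ z : ℂ, ‖z‖ = 1 → ∑ k ∈ S, (w k : ℂ) * z ^ e k ≠ 0) ∧ ∑' k, |p k - w k| < ε := by
  classical
  obtain ⟨S, hS1, hS2⟩ : ∃ S : Finset ℤ, 1 - ε / 2 < ∑ k ∈ S, p k ∧ 0 < ∑ k ∈ S, p k :=
    ((hs.eventually (lt_mem_nhds (by linarith : 1 - ε / 2 < 1))).and
      (hs.eventually (lt_mem_nhds one_pos))).exists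
  set m := ∑ k ∈ S, p k with hm
  have hm1 : m ≤ 1 := sum_le_hasSum S (fun k _ => hp k) hs
  -- A shift making every exponent `k + N`, `k ∈ S`, nonnegative.
  set N : ℤ := ∑ k ∈ S, |k| with hN
  set e : ℤ → ℕ := fun k => (k + N).toNat with he
  have heN : ∀ k ∈ S, (e k : ℤ) = k + N := fun k hk => by
    have h1 : |k| ≤ N := Finset.single_le_sum (f := fun k : ℤ => |k|) (fun i _ => abs_nonneg i) hk
    have h2 := neg_abs_le k
    exact Int.toNat_of_nonneg (by linarith)
  set Z : ℝ → ℝ := fun r => ∑ k ∈ S, p k * r ^ e k with hZ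
  have hZ1 : Z 1 = m := by simp [hZ, hm]
  set w : ℝ → ℤ → ℝ := fun r k => if k ∈ S then p k * r ^ e k / Z r else 0 with hw
  -- The `ℓ¹` distance as a finite sum, hence continuous at `1`: off `S` each term is `p k`, and `∑
  -- p k = 1`.
  set ψ : ℝ → ℝ := fun r => 1 + ∑ k ∈ S, (|p k - p k * r ^ e k / Z r| - p k) with hψ
  have hψsum (r : ℝ) : ∑' k, |p k - w r k| = ψ r := by
    have h1 : HasSum (fun k => if k ∈ S then |p k - p k * r ^ e k / Z r| - p k else 0)
        (∑ k ∈ S, (|p k - p k * r ^ e k / Z r| - p k)) := by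
      convert hasSum_sum_of_ne_finset_zero (s := S) (L := .unconditional ℤ)
        (f := fun k => if k ∈ S then |p k - p k * r ^ e k / Z r| - p k else 0) ?_ using 1
      · exact Finset.sum_congr rfl fun k hk => by simp [hk]
      · intro k hk
        simp [hk]
    refine Eq.trans ?_ (hs.add h1).tsum_eq
    congr 1 with k
    by_cases hk : k ∈ S
    · simp [hw, hk]
    · simp [hw, hk, abs_of_nonneg (hp k)]
  -- Without tilting the weights on `S` are `p k / m ≥ p k`, so `ψ 1 = 2(1 - m)`.
  have hψ1 : ψ 1 < ε := by
    have h : ∀ k ∈ S, |p k - p k * 1 ^ e k / Z 1| - p k = p k * (m⁻¹ - 2) := fun k _ => by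
      have h1 : 1 ≤ m⁻¹ := (one_le_inv₀ hS2).2 hm1
      rw [hZ1, one_pow, mul_one, div_eq_mul_inv, abs_of_nonpos (by nlinarith [hp k])]
      ring
    rw [hψ]
    beta_reduce
    rw [Finset.sum_congr rfl h, ← Finset.sum_mul, ← hm, mul_sub, mul_inv_cancel₀ hS2.ne']
    linarith
  have hψcont : ContinuousAt ψ 1 := by
    have hZc : ContinuousAt Z 1 := by fun_prop
    have hZ0 : Z 1 ≠ 0 := by rw [hZ1]; exact hS2.ne'
    fun_prop (disch := assumption)
  obtain ⟨δ, hδ, hδε⟩ := Metric.eventually_nhds_iff.1 (hψcont.eventually (gt_mem_nhds hψ1))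
  set P : Polynomial ℂ := ∑ k ∈ S, Polynomial.C (p k : ℂ) * Polynomial.X ^ e k with hP
  have hPeval (z : ℂ) : P.eval z = ∑ k ∈ S, (p k : ℂ) * z ^ e k := by
    simp [hP, Polynomial.eval_finsetSum]
  have hP0 : P ≠ 0 := fun h => by
    have h1 := hPeval 1
    simp only [h, Polynomial.eval_zero, one_pow, mul_one] at h1
    exact hS2.ne (by exact_mod_cast h1)
  obtain ⟨r, hr1, hr2, hr⟩ := exists_scale_eval_ne_zero hP0 hδ
  have hr0 : 0 < r := by linarith
  have hterm (k : ℤ) : 0 ≤ p k * r ^ e k := mul_nonneg (hp k) (by positivity)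
  have hZpos : 0 < Z r := by
    refine (Finset.sum_nonneg fun k _ => hterm k).lt_of_ne fun h => hr 1 (by simp) ?_
    rw [hPeval, mul_one]
    exact_mod_cast h.symm
  refine ⟨S, N, e, w r, fun k => ?_, fun k hk => by simp [hw, hk], fun k hk => by simp [hw, hk], ?_,
    heN, fun z hz => ?_, ?_⟩
  · by_cases hk : k ∈ S
    · simpa [hw, hk] using div_nonneg (hterm k) hZpos.le
    · simp [hw, hk]
  · calc ∑ k ∈ S, w r k = ∑ k ∈ S, p k * r ^ e k / Z r :=
        Finset.sum_congr rfl fun k hk => by simp [hw, hk]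
      _ = 1 := by rw [← Finset.sum_div]; exact div_self hZpos.ne'
  · have h : ∑ k ∈ S, (w r k : ℂ) * z ^ e k = P.eval (r * z) / Z r := by
      rw [hPeval, Finset.sum_div]
      refine Finset.sum_congr rfl fun k hk => ?_
      simp only [hw, hk, if_true]
      push_cast
      rw [mul_pow]
      ring
    rw [h]
    exact div_ne_zero (hr z hz) (by exact_mod_cast hZpos.ne')
  · rw [hψsum]
    refine hδε ?_
    rw [Real.dist_eq, abs_of_pos (by linarith)]
    linarith

end Tilting

/-! ### Density on subsets of a lattice -/

theorem denseInVariation_RIDdiscOn {a b : ℝ} {L : Set ℝ} (hb : 0 < b) (hL : L ⊆ lattice a b) :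
    DenseInVariation (RIDdiscOn L) (DFdiscOn L) := by
  rintro F ⟨_, hF⟩ ε hε
  set x : ℤ → ℝ := fun k => a + b * k with hx
  have hinj : Function.Injective x := fun i j h => by
    simpa [hx, hb.ne'] using h
  set p : ℤ → ℝ := fun k => (F : Measure ℝ).real {x k} with hpdef
  have hp (k : ℤ) : 0 ≤ p k := measureReal_nonneg
  have hFp : (F : Measure ℝ) = atomic p x := eq_atomic hinj _ <|
    measure_mono_null (compl_subset_compl.2 (hF.trans hL)) Measure.measure_compl_support
  have hsum : HasSum p 1 := by
    have h1 : ∑' k, ENNReal.ofReal (p k) = 1 := by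
      have := measure_univ (μ := (F : Measure ℝ))
      rw [hFp, atomic_apply MeasurableSet.univ] at this
      simpa using this
    have h2 := ENNReal.summable_toReal (h1 ▸ ENNReal.one_ne_top)
    have h3 := ENNReal.tsum_toReal_eq (f := fun k => ENNReal.ofReal (p k)) fun k =>
      ENNReal.ofReal_ne_top
    simp only [ENNReal.toReal_ofReal (hp _), h1, ENNReal.toReal_one] at h2 h3
    exact h3 ▸ h2.hasSum
  obtain ⟨S, N, e, w, hw, hwS, hwp, hw1, heN, hz, hlt⟩ := exists_tilted_weights hp hsum hε
  have hwsum : HasSum w 1 := hw1 ▸ hasSum_sum_of_ne_finset_zero hwS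
  have hprob : IsProbabilityMeasure (atomic w x) :=
    ⟨by rw [atomic_univ hw hwsum.summable, hwsum.tsum_eq, ENNReal.ofReal_one]⟩
  set G : ProbabilityMeasure ℝ := ⟨atomic w x, hprob⟩ with hG
  -- Every atom of `G` is an atom of `F`, hence in its support; this handles arbitrary `L`.
  have hwL (k : ℤ) (hk : w k ≠ 0) : x k ∈ L := by
    refine hF ((Measure.mem_support_iff_forall _).2 fun U hU => ?_)
    have hpk : (F : Measure ℝ) {x k} ≠ 0 := fun h =>
      hk (hwp k (by simp [hpdef, measureReal_def, h]))
    exact (pos_iff_ne_zero.2 hpk).trans_le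
      (measure_mono (singleton_subset_iff.2 (mem_of_mem_nhds hU)))
  have hsupp := support_atomic_subset (x := x) hwS hwL
  refine ⟨G, ⟨?_, hsupp.2, hsupp.1⟩, (varDist_le_tsum hFp rfl hp hw hsum.summable
    hwsum.summable).trans_lt ((ENNReal.ofReal_lt_ofReal_iff hε).2 hlt)⟩
  set Q : Polynomial ℂ := ∑ k ∈ S, Polynomial.C (w k : ℂ) * Polynomial.X ^ e k with hQ
  have hQeval (z : ℂ) : Q.eval z = ∑ k ∈ S, (w k : ℂ) * z ^ e k := by
    simp [hQ, Polynomial.eval_finsetSum]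
  -- The shift `-b * N` undoes the exponent shift by `N`.
  refine mem_RID_of_charFun_eq_eval G (a - b * N) b (P := Q)
    (fun z h => by rw [hQeval]; exact hz z h) fun t => ?_
  change charFun (atomic w x) t = _
  rw [charFun_atomic hw hwsum.summable, hQeval,
    tsum_eq_sum (s := S) fun k hk => by simp [hwS k hk], Finset.mul_sum]
  refine Finset.sum_congr rfl fun k hk => ?_
  rw [mul_left_comm, ← Complex.exp_nat_mul, ← Complex.exp_add]
  have h : (e k : ℂ) = k + N := by exact_mod_cast heN k hk
  rw [h, hx]
  congr 2
  push_cast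
  ring

end RationalID

theorem theorem2 :
    (∀ (a b : ℝ) (L : Set ℝ), 0 < b → L ⊆ RationalID.lattice a b → L.Nonempty →
      RationalID.DenseInVariation (RationalID.RIDdiscOn L) (RationalID.DFdiscOn L)) ∧
    RationalID.DenseInVariation RationalID.RIDlat RationalID.DFlat := by
  refine ⟨fun a b L hb hL _ => RationalID.denseInVariation_RIDdiscOn hb hL, ?_⟩
  rintro F ⟨hF, a, b, hb, hsupp⟩ ε hε
  obtain ⟨G, ⟨hR, hD, hG⟩, hlt⟩ :=
    RationalID.denseInVariation_RIDdiscOn hb (a := a) Set.Subset.rfl F ⟨hF, hsupp⟩ ε hε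
  exact ⟨G, ⟨hR, hD, a, b, hb, hG⟩, hlt⟩
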